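/- Let $H$ be a complex Hilbert space and let $T$ be a bounded linear operator on $H$ that is normal, i.e. $TT^*=T^*T$. Suppose that $T$ is absolutely minimum attaining (an $\mathcal{AM}$-operator): for every nonzero closed subspace $M\subseteq H$ there is a unit vector $x\in M$ with $\|Tx\|=\inf\{\|Ty\| : y\in M,\ \|y\|=1\}$. Put $|T|=\sqrt{T^*T}$ and let $\Lambda=\sigma(|T|)$ be its spectrum. Then there exists a family $(H_\beta,U_\beta)_{\beta\in\Lambda}$, where each $H_\beta$ is a (possibly zero) closed subspace of $H$ that reduces $T$, i.e. $T(H_\beta)\subseteq H_\beta$ and $T(H_\beta^\perp)\subseteq H_\beta^\perp$, and each $U_\beta$ is a unitary operator on $H_\beta$, such that 1. $H=\bigoplus_{\beta\in\Lambda}H_\beta$ (orthogonal Hilbert space direct sum); 2. $T=\bigoplus_{\beta\in\Lambda}\beta U_\beta$, i.e. if $x\in H$ has components $(x_\beta)_{\beta\in\Lambda}$, then $Tx$ has components $(\beta U_\beta x_\beta)_{\beta\in\Lambda}$. -/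

import Mathlib

section AMOperators

variable {H₁ H₂ : Type*} [NormedAddCommGroup H₁] [InnerProductSpace ℂ H₁]
  [NormedAddCommGroup H₂] [InnerProductSpace ℂ H₂]

/-- The minimum modulus `m(T) = inf {‖T x‖ : ‖x‖ = 1}`. -/
noncomputable def minModulus (T : H₁ →L[ℂ] H₂) : ℝ :=
  sInf {r : ℝ | ∃ x : H₁, ‖x‖ = 1 ∧ r = ‖T x‖}

/-- `T` is minimum attaining: `‖T x‖ = m(T)` for some unit vector `x`. -/
def IsMinimumAttaining (T : H₁ →L[ℂ] H₂) : Prop :=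
  ∃ x : H₁, ‖x‖ = 1 ∧ minModulus T = ‖T x‖

/-- `T` is absolutely minimum attaining: its restriction to every closed subspace `M` is minimum
attaining. The zero subspace is left out, since it has no unit vectors. -/
def IsAbsolutelyMinimumAttaining (T : H₁ →L[ℂ] H₂) : Prop :=
  ∀ M : Submodule ℂ H₁, IsClosed (M : Set H₁) → M ≠ ⊥ → IsMinimumAttaining (T ∘L M.subtypeL)

end AMOperators

section DirectSums

variable {H : Type*} [NormedAddCommGroup H] [InnerProductSpace ℂ H]

/-- The closed subspace `M` reduces `T`: both `M` and its orthogonal complement are invariant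
under `T`. -/
def IsReducingSubspace (T : H →L[ℂ] H) (M : ClosedSubmodule ℂ H) : Prop :=
  (∀ x ∈ M.toSubmodule, T x ∈ M.toSubmodule) ∧
    ∀ x ∈ M.toSubmoduleᗮ, T x ∈ M.toSubmoduleᗮ

/-- `H` is the orthogonal (Hilbert space) direct sum of the closed subspaces `M i`. -/
def IsOrthogonalDirectSum [CompleteSpace H] {ι : Type*} (M : ι → ClosedSubmodule ℂ H) : Prop :=
  IsHilbertSum ℂ (fun i => (M i).toSubmodule) (fun i => (M i).toSubmodule.subtypeₗᵢ)

/-- `T = ⨁ S i` with respect to the orthogonal decomposition `H = ⨁ M i`: writing `x ∈ H` through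
its components `(x i)`, the components of `T x` are `(S i (x i))`. -/
def IsDirectSumOperator [CompleteSpace H] {ι : Type*} {M : ι → ClosedSubmodule ℂ H}
    (hM : IsOrthogonalDirectSum M) (T : H →L[ℂ] H)
    (S : ∀ i, (M i).toSubmodule →L[ℂ] (M i).toSubmodule) : Prop :=
  ∀ (x : H) (i : ι),
    IsHilbertSum.linearIsometryEquiv hM (T x) i =
      S i (IsHilbertSum.linearIsometryEquiv hM x i)

instance ClosedSubmodule.completeSpace_toSubmodule [CompleteSpace H] (M : ClosedSubmodule ℂ H) :
    CompleteSpace M.toSubmodule :=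
  M.isClosed.completeSpace_coe

end DirectSums

/-! The summands are the eigenspaces of `P = |T|`, zero when `β` is not an eigenvalue. They are
mutually orthogonal since `P` is self-adjoint. Let `N` be the orthogonal complement of their sum. If
`N ≠ 0`, then `‖T x‖` attains its minimum `m` on the unit sphere of `N`; a minimizer is an
eigenvector of `P² = T†T` for `m²`, and factoring `P² - m²` yields an eigenvector of `P` in `N`,
which is impossible. Normality makes `P` commute with `T` and `T†`, so each eigenspace reduces `T`,
and `T†T = TT† = β²` there makes `β⁻¹ T` unitary when `β ≠ 0`. -/

section EigenspaceDecomposition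

open Module.End ContinuousLinearMap

variable {H : Type*} [NormedAddCommGroup H] [InnerProductSpace ℂ H]

/-- The eigenspace of a bounded operator, as a closed subspace. -/
def closedEigenspace (P : H →L[ℂ] H) (μ : ℂ) : ClosedSubmodule ℂ H where
  toSubmodule := eigenspace (P : H →ₗ[ℂ] H) μ
  isClosed' := by
    have h : (eigenspace (P : H →ₗ[ℂ] H) μ : Set H) = {x | P x = μ • x} := by
      ext x
      simp
    change IsClosed (eigenspace (P : H →ₗ[ℂ] H) μ : Set H)
    rw [h]
    exact isClosed_eq P.continuous (continuous_const_smul μ)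

lemma mem_closedEigenspace {P : H →L[ℂ] H} {μ : ℂ} {x : H} :
    x ∈ (closedEigenspace P μ).toSubmodule ↔ P x = μ • x :=
  mem_eigenspace_iff

lemma apply_mem_closedEigenspace_of_commute {P S : H →L[ℂ] H} (h : Commute P S) {μ : ℂ} {x : H}
    (hx : x ∈ (closedEigenspace P μ).toSubmodule) : S x ∈ (closedEigenspace P μ).toSubmodule := by
  rw [mem_closedEigenspace] at hx ⊢
  have : P (S x) = S (P x) := congr($(h.eq) x)
  rw [this, hx, map_smul]

lemma mem_spectrum_of_apply_eq_smul {P : H →L[ℂ] H} {μ : ℂ} {x : H} (hx : x ≠ 0)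
    (h : P x = μ • x) : μ ∈ spectrum ℂ P := by
  rw [spectrum.mem_iff]
  intro hu
  obtain ⟨v, hv⟩ := hu.exists_left_inv
  apply hx
  have := congr($hv x)
  simpa [mul_apply, sub_apply, h, Algebra.algebraMap_eq_smul_one] using this.symm

/-- The minimum modulus is a lower bound: a minimum attaining operator attains its least norm on
the unit sphere. -/
lemma IsMinimumAttaining.exists_norm_le {H₂ : Type*} [NormedAddCommGroup H₂]
    [InnerProductSpace ℂ H₂] {T : H →L[ℂ] H₂} (hT : IsMinimumAttaining T) :
    ∃ x : H, ‖x‖ = 1 ∧ ∀ y : H, ‖y‖ = 1 → ‖T x‖ ≤ ‖T y‖ := by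
  obtain ⟨x, hx, hm⟩ := hT
  refine ⟨x, hx, fun y hy => hm ▸ csInf_le ⟨0, ?_⟩ ⟨y, hy, rfl⟩⟩
  rintro r ⟨z, -, rfl⟩
  exact norm_nonneg _

variable [CompleteSpace H]

lemma IsReducingSubspace.of_adjoint {T : H →L[ℂ] H} {M : ClosedSubmodule ℂ H}
    (hT : ∀ x ∈ M.toSubmodule, T x ∈ M.toSubmodule)
    (hT' : ∀ x ∈ M.toSubmodule, adjoint T x ∈ M.toSubmodule) : IsReducingSubspace T M := by
  refine ⟨hT, fun x hx => ?_⟩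
  rw [Submodule.mem_orthogonal] at hx ⊢
  intro v hv
  rw [← adjoint_inner_left]
  exact hx _ (hT' v hv)

/-- Identifies the abstract components with orthogonal projections, so that they can be compared by
testing against vectors of `M i`. -/
lemma inner_linearIsometryEquiv_apply {ι : Type*} {M : ι → ClosedSubmodule ℂ H}
    (hM : IsOrthogonalDirectSum M) (x : H) (i : ι) (v : (M i).toSubmodule) :
    inner ℂ v (IsHilbertSum.linearIsometryEquiv hM x i) = inner ℂ (v : H) x := by
  classical
  have h := IsHilbertSum.linearIsometryEquiv_symm_apply_single hM v
  refine (lp.inner_single_left (𝕜 := ℂ) (G := fun i => (M i).toSubmodule) i v _).symm.trans ?_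
  rw [← LinearIsometryEquiv.inner_map_map (IsHilbertSum.linearIsometryEquiv hM).symm, h,
    LinearIsometryEquiv.symm_apply_apply]
  rfl

/-- Subspaces invariant under `T` and its adjoint decompose `T` as a direct sum. -/
lemma isDirectSumOperator_of_invariant {ι : Type*} {M : ι → ClosedSubmodule ℂ H}
    (hM : IsOrthogonalDirectSum M) {T : H →L[ℂ] H}
    {S : ∀ i, (M i).toSubmodule →L[ℂ] (M i).toSubmodule}
    (hS : ∀ i (x : (M i).toSubmodule), (S i x : H) = T x)
    (hT' : ∀ i, ∀ x ∈ (M i).toSubmodule, adjoint T x ∈ (M i).toSubmodule) :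
    IsDirectSumOperator hM T S := by
  intro x i
  refine ext_inner_left ℂ fun v => ?_
  rw [inner_linearIsometryEquiv_apply, Submodule.coe_inner, hS, ← adjoint_inner_left,
    ← adjoint_inner_left]
  exact (inner_linearIsometryEquiv_apply hM x i ⟨adjoint T v, hT' i v v.2⟩).symm

/-- An operator that attains its minimum on a closed subspace `N` invariant under `T† T` has an
eigenvector of `T† T` in `N`, with the square of a real number as eigenvalue. -/
lemma exists_eigenvector_adjoint_mul_self {T : H →L[ℂ] H} {N : Submodule ℂ H} [CompleteSpace N]
    (hN : ∀ x ∈ N, adjoint T (T x) ∈ N) (hT : IsMinimumAttaining (T ∘L N.subtypeL)) :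
    ∃ x ∈ N, x ≠ 0 ∧ ∃ m : ℝ, adjoint T (T x) = ((m : ℂ) ^ 2) • x := by
  obtain ⟨x, hx, hmin⟩ := hT.exists_norm_le
  set R := T ∘L N.subtypeL with hR
  have hself : IsSelfAdjoint (adjoint R ∘L R) := (isPositive_adjoint_comp_self R).isSelfAdjoint
  have hre : ∀ y, (adjoint R ∘L R).reApplyInnerSelf y = ‖R y‖ ^ 2 := fun y => by
    rw [reApplyInnerSelf_apply, ← apply_norm_sq_eq_inner_adjoint_left]
  have hx0 : x ≠ 0 := by
    rintro rfl
    simp at hx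
  -- Lagrange multipliers: an extremum of the quadratic form of `R†R` on a sphere is an eigenvector,
  -- its eigenvalue being the Rayleigh quotient.
  have hE := hself.eq_smul_self_of_isLocalExtrOn (x₀ := x) <| Or.inl <| IsMinOn.localize <| by
    intro y hy
    rw [hx, mem_sphere_zero_iff_norm] at hy
    simp only [Set.mem_ofPred_eq, hre]
    gcongr
    exact hmin y hy
  refine ⟨x, x.2, by simpa using hx0, ‖R x‖, ?_⟩
  have hq : (adjoint R ∘L R).rayleighQuotient x = ‖R x‖ ^ 2 := by
    simp [rayleighQuotient, hre, hx]
  rw [hq] at hE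
  -- `R†R` is the compression of `T†T` to `N`; by invariance of `N` it is the restriction.
  suffices h : (⟨adjoint T (T x), hN x x.2⟩ : N) = ((‖R x‖ : ℂ) ^ 2) • x from
    congr_arg Subtype.val h
  refine ext_inner_left ℂ fun v => ?_
  have := congr(inner ℂ v $hE)
  rw [comp_apply, adjoint_inner_right] at this
  push_cast at this
  refine Eq.trans ?_ this
  rw [Submodule.coe_inner, adjoint_inner_right]
  rfl

/-- The eigenvectors of the absolute value of an absolutely minimum attaining operator are
total. -/
lemma IsAbsolutelyMinimumAttaining.orthogonal_iSup_closedEigenspace_abs {T : H →L[ℂ] H}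
    (hT : IsAbsolutelyMinimumAttaining T) :
    (⨆ β : spectrum ℂ (CFC.abs T), (closedEigenspace (CFC.abs T) β).toSubmodule)ᗮ = ⊥ := by
  set P := CFC.abs T with hP
  have hpos : P.IsPositive := (nonneg_iff_isPositive P).1 (CFC.abs_nonneg T)
  set N := (⨆ β : spectrum ℂ P, (closedEigenspace P β).toSubmodule)ᗮ with hNdef
  have hPP : ∀ x, P (P x) = adjoint T (T x) := fun x => congr($(CFC.abs_mul_abs T) x)
  have hNP : ∀ x ∈ N, P x ∈ N := by
    intro x hx
    rw [hNdef, ← Submodule.iInf_orthogonal, Submodule.mem_iInf] at hx ⊢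
    intro β
    have hr := IsReducingSubspace.of_adjoint (T := P) (M := closedEigenspace P β)
      (fun x => apply_mem_closedEigenspace_of_commute (.refl P))
      (fun x => by
        rw [hpos.isSelfAdjoint.adjoint_eq]
        exact apply_mem_closedEigenspace_of_commute (.refl P))
    exact hr.2 x (hx β)
  have hno : ∀ x ∈ N, ∀ μ : ℂ, P x = μ • x → x = 0 := by
    intro x hx μ h
    by_contra hx0
    have hμ := mem_spectrum_of_apply_eq_smul hx0 h
    have hmem : x ∈ ⨆ β : spectrum ℂ P, (closedEigenspace P β).toSubmodule :=
      Submodule.mem_iSup_of_mem ⟨μ, hμ⟩ (mem_closedEigenspace.2 h)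
    exact hx0 (inner_self_eq_zero.1 (Submodule.inner_right_of_mem_orthogonal hmem hx))
  by_contra hN
  obtain ⟨x, hxN, hx0, m, hx⟩ := exists_eigenvector_adjoint_mul_self
    (fun x hx => hPP x ▸ hNP _ (hNP x hx)) (hT N (Submodule.isClosed_orthogonal _) hN)
  have hyN : P x - (m : ℂ) • x ∈ N := N.sub_mem (hNP x hxN) (N.smul_mem _ hxN)
  -- This is `(P + m)(P - m)x = 0`. Using `hno` at `-m` gives `(P - m)x = 0`, and then at `m` gives
  -- `x = 0`.
  have hy : P (P x - (m : ℂ) • x) = (-m : ℂ) • (P x - (m : ℂ) • x) := by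
    rw [map_sub, map_smul, hPP, hx]
    module
  exact hx0 (hno x hxN m (sub_eq_zero.1 (hno _ hyN _ hy)))

lemma isOrthogonalDirectSum_closedEigenspace {P : H →L[ℂ] H} (hP : IsSelfAdjoint P)
    (h : (⨆ β : spectrum ℂ P, (closedEigenspace P β).toSubmodule)ᗮ = ⊥) :
    IsOrthogonalDirectSum fun β : spectrum ℂ P => closedEigenspace P β := by
  refine IsHilbertSum.mkInternal _
    (hP.isSymmetric.orthogonalFamily_eigenspaces.comp Subtype.coe_injective) ?_
  rw [← Submodule.orthogonal_orthogonal_eq_closure, h, Submodule.bot_orthogonal_eq_top]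

/-- Since `r` is real, taking the adjoint leaves the scalar `r⁻¹` unchanged. -/
lemma inv_smul_mem_unitary {A B : H →L[ℂ] H} {r : ℝ} (hr : r ≠ 0) (hAB : adjoint A = B)
    (h : ∀ x, B (A x) = ((r : ℂ) * r) • x) (h' : ∀ x, A (B x) = ((r : ℂ) * r) • x) :
    (r : ℂ)⁻¹ • A ∈ unitary (H →L[ℂ] H) := by
  have hr' : (r : ℂ) ≠ 0 := by exact_mod_cast hr
  have hs : star ((r : ℂ)⁻¹ • A) = (r : ℂ)⁻¹ • B := by
    rw [star_smul, star_eq_adjoint, hAB]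
    simp
  have hrr : (r : ℂ)⁻¹ * (r : ℂ)⁻¹ * (r * r) = 1 := by field_simp
  rw [Unitary.mem_iff, hs]
  constructor <;> ext x <;> simp [h, h', smul_smul, hrr]

/-- If `T† T` and `T T†` are `β²` on a subspace invariant under `T` and `T†`, then `T` acts on it as
`β` times a unitary operator. -/
lemma exists_unitary_of_invariant {T : H →L[ℂ] H} {K : Submodule ℂ H} [CompleteSpace K] {β : ℝ}
    (hβ : β ≠ 0) (hT : ∀ x ∈ K, T x ∈ K) (hT' : ∀ x ∈ K, adjoint T x ∈ K)
    (h : ∀ x ∈ K, adjoint T (T x) = ((β : ℂ) * β) • x)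
    (h' : ∀ x ∈ K, T (adjoint T x) = ((β : ℂ) * β) • x) :
    ∃ U ∈ unitary (K →L[ℂ] K), ∀ x, (((β : ℂ) • U) x : H) = T x := by
  have hβ' : (β : ℂ) ≠ 0 := by exact_mod_cast hβ
  have hAB : adjoint (T.restrict hT) = (adjoint T).restrict hT' := by
    rw [eq_comm, eq_adjoint_iff]
    exact fun x y => adjoint_inner_left T (y : H) (x : H)
  refine ⟨(β : ℂ)⁻¹ • T.restrict hT, inv_smul_mem_unitary hβ hAB
    (fun x => Subtype.ext (h x x.2)) (fun x => Subtype.ext (h' x x.2)), fun x => ?_⟩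
  rw [smul_inv_smul₀ hβ']
  rfl

/-- A normal operator acts on an eigenspace of its absolute value, for a real eigenvalue `β`, as
`β` times a unitary operator. -/
lemma exists_unitary_closedEigenspace_abs {T : H →L[ℂ] H} (hT : IsStarNormal T) (β : ℝ) :
    ∃ U ∈ unitary ((closedEigenspace (CFC.abs T) β).toSubmodule →L[ℂ]
        (closedEigenspace (CFC.abs T) β).toSubmodule),
      ∀ x, (((β : ℂ) • U) x : H) = T x := by
  set P := CFC.abs T with hP
  have hPP : ∀ x, P (P x) = adjoint T (T x) := fun x => congr($(CFC.abs_mul_abs T) x)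
  have hc : Commute P T := CFC.commute_abs_self T
  have hc' : Commute P (adjoint T) := by
    have := CFC.commute_abs_self (star T)
    rwa [CFC.abs_star T] at this
  have hsq : ∀ x ∈ (closedEigenspace P β).toSubmodule, adjoint T (T x) = ((β : ℂ) * β) • x := by
    intro x hx
    rw [mem_closedEigenspace] at hx
    rw [← hPP, hx, map_smul, hx, smul_smul]
  have hnc : ∀ x, T (adjoint T x) = adjoint T (T x) := fun x =>
    congr($(hT.star_comm_self.eq.symm) x)
  rcases eq_or_ne β 0 with rfl | hβ
  -- On the kernel of `P` the operator `T` vanishes, so any unitary serves.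
  · refine ⟨1, one_mem _, fun x => ?_⟩
    have h0 : adjoint T (T x) = 0 := by simpa using hsq x x.2
    have h1 : inner ℂ (T (x : H)) (T (x : H)) = 0 := by
      rw [← adjoint_inner_left, h0, inner_zero_left]
    simp [inner_self_eq_zero.1 h1]
  · exact exists_unitary_of_invariant hβ
      (fun _ hx => apply_mem_closedEigenspace_of_commute hc hx)
      (fun _ hx => apply_mem_closedEigenspace_of_commute hc' hx) hsq
      (fun x hx => (hnc x).trans (hsq x hx))

end EigenspaceDecomposition

theorem theorem4p9 {H : Type*} [NormedAddCommGroup H] [InnerProductSpace ℂ H] [CompleteSpace H]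
    (T : H →L[ℂ] H) (hnormal : IsStarNormal T) (hAM : IsAbsolutelyMinimumAttaining T) :
    ∃ (M : spectrum ℂ (CFC.abs T) → ClosedSubmodule ℂ H)
      (U : ∀ β, (M β).toSubmodule →L[ℂ] (M β).toSubmodule),
      (∀ β, IsReducingSubspace T (M β)) ∧
      (∀ β, U β ∈ unitary ((M β).toSubmodule →L[ℂ] (M β).toSubmodule)) ∧
      ∃ hM : IsOrthogonalDirectSum M,
        IsDirectSumOperator hM T (fun β => (β : ℂ) • U β) := by
  have hsa : IsSelfAdjoint (CFC.abs T) := (CFC.abs_nonneg T).isSelfAdjoint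
  have hc : Commute (CFC.abs T) T := CFC.commute_abs_self T
  have hc' : Commute (CFC.abs T) (ContinuousLinearMap.adjoint T) := by
    have := CFC.commute_abs_self (star T)
    rwa [CFC.abs_star T] at this
  have hU : ∀ β : spectrum ℂ (CFC.abs T),
      ∃ U ∈ unitary ((closedEigenspace (CFC.abs T) β).toSubmodule →L[ℂ]
        (closedEigenspace (CFC.abs T) β).toSubmodule), ∀ x, (((β : ℂ) • U) x : H) = T x := by
    rintro ⟨β, hβ⟩
    -- The index set lies in `ℂ`, but the spectrum of a self-adjoint operator is real.
    have hre : β = (β.re : ℂ) := hsa.mem_spectrum_eq_re hβ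
    generalize β.re = r at hre
    subst hre
    exact exists_unitary_closedEigenspace_abs hnormal r
  choose U hU hUT using hU
  exact ⟨fun β => closedEigenspace (CFC.abs T) β, U,
    fun β => .of_adjoint (fun _ hx => apply_mem_closedEigenspace_of_commute hc hx)
      (fun _ hx => apply_mem_closedEigenspace_of_commute hc' hx),
    hU,
    isOrthogonalDirectSum_closedEigenspace hsa hAM.orthogonal_iSup_closedEigenspace_abs,
    isDirectSumOperator_of_invariant _ hUT
      (fun _ _ hx => apply_mem_closedEigenspace_of_commute hc' hx)⟩
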